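/- **Setting.** All languages are first-order, with the individual variables as the only terms and, for each $n\ge 0$, countably many $n$-ary logical (predicate) variables; $\neg A$ abbreviates $A\to$ falsity, $A\leftrightarrow B$ abbreviates $(A\to B)\land(B\to A)$. For each calculus below, $\Gamma\vdash A$ (equivalently: the rule $\Gamma/A$ is *derivable*) means that $A$ has a Hilbert-style derivation from the axioms and the premises $\Gamma$, in which all inference rules, including generalization $A/\forall x\,A$, may be applied to formulas depending on the premises. * QC is classical predicate calculus, with connectives $0,\land,\lor,\to,\forall,\exists$. * QS4 is QC with an additional unary connective $\Box$ (the axioms and rules of QC being applied to all modal formulas), the axiom schemes $\Box p\to p$, $\Box p\to\Box\Box p$, $\Box(p\to q)\to(\Box p\to\Box q)$, and the rule $p/\Box p$. * QHC has two types of formulas, *propositions* $p,q,\dots$ and *problems* $\alpha,\beta,\dots$, with logical variables of both types. Propositions are closed under the classical connectives $0,\land,\lor,\to,\forall,\exists$, problems under the intuitionistic connectives $\bot,\land,\lor,\to,\forall,\exists$; if $\alpha$ is a problem then $?\alpha$ is a proposition, and if $p$ is a proposition then $!p$ is a problem. Its axioms and rules are those of classical predicate logic for all propositions, those of intuitionistic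 predicate logic for all problems, the rules $\alpha/?\alpha$ and $p/!p$, and the axiom schemes $?(\alpha\land\beta)\leftrightarrow{?\alpha}\land{?\beta}$; $?(\alpha\lor\beta)\leftrightarrow{?\alpha}\lor{?\beta}$; $?(\alpha\to\beta)\to(?\alpha\to{?\beta})$; $\neg?\bot$; $?\exists x\,\alpha\leftrightarrow\exists x\,?\alpha$; $?\forall x\,\alpha\to\forall x\,?\alpha$; $\neg!0$; $?!p\to p$; $!(p\to q)\to(!p\to{!q})$; $\alpha\to{!?\alpha}$. A formula of QC is regarded as a proposition of QHC in the obvious way, and a formula of QS4 is regarded as a proposition of QHC by reading $\Box$ as $?!$. A calculus $L'$ is a *strongly conservative extension* of a calculus $L$ via an injective translation $A\mapsto A'$ of the formulas of $L$ into those of $L'$ if for every set $\Gamma$ of formulas of $L$ and every formula $A$ of $L$, $$\{G' : G\in\Gamma\}\vdash_{L'}A'\iff\Gamma\vdash_L A .$$ **Theorem.** (a) QHC is a strongly conservative extension of QC. (b) QHC is a strongly conservative extension of QS4, via $\Box\mapsto{?!}$. In particular, every derivable rule of QHC that is expressed in the language of QS4 is derivable in QS4. -/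

import Mathlib

/-! Individual variables are indexed by `ℕ` and are the only terms. In all three calculi `¬ A`
abbreviates `A → falsity` and `A ↔ B` abbreviates `(A → B) ∧ (B → A)`. All consequence relations
are those of Hilbert-style derivations from premises, in which every inference rule (including
generalization, necessitation, and the rules for `?` and `!`) may be applied to the premises:
`Γ ⊢ A` says that `A` is derivable from `Γ`, i.e. that the rule `Γ / A` is derivable. -/

/-! ### The classical predicate calculus QC -/

namespace QC

/-- Formulas of QC. -/
inductive Formula : Type
  /-- the `k`-th `n`-ary logical (predicate) variable, applied to individual variables -/
  | var (n k : ℕ) (ts : Fin n → ℕ) : Formula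
  /-- the falsity constant `0` -/
  | bot : Formula
  | and : Formula → Formula → Formula
  | or : Formula → Formula → Formula
  | imp : Formula → Formula → Formula
  | all (x : ℕ) : Formula → Formula
  | ex (x : ℕ) : Formula → Formula

namespace Formula

/-- The parameters (free individual variables) of a formula. -/
def fv : Formula → Set ℕ
  | .var _ _ ts => Set.range ts
  | .bot => ∅
  | .and A B => fv A ∪ fv B
  | .or A B => fv A ∪ fv B
  | .imp A B => fv A ∪ fv B
  | .all x A => fv A \ {x}
  | .ex x A => fv A \ {x}

/-- `A.subst x t` is the result of replacing every free occurrence of the variable `x` in `A`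
by the variable `t`. -/
def subst (x t : ℕ) : Formula → Formula
  | .var n k ts => .var n k (fun i => if ts i = x then t else ts i)
  | .bot => .bot
  | .and A B => .and (subst x t A) (subst x t B)
  | .or A B => .or (subst x t A) (subst x t B)
  | .imp A B => .imp (subst x t A) (subst x t B)
  | .all y A => .all y (if y = x then A else subst x t A)
  | .ex y A => .ex y (if y = x then A else subst x t A)

/-- `A.FreeFor x t`: the variable `t` is free for `x` in `A`, i.e. no free occurrence of `x` in `A`
lies within the scope of a quantifier binding `t`. -/
def FreeFor (x t : ℕ) : Formula → Prop
  | .var _ _ _ => True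
  | .bot => True
  | .and A B => FreeFor x t A ∧ FreeFor x t B
  | .or A B => FreeFor x t A ∧ FreeFor x t B
  | .imp A B => FreeFor x t A ∧ FreeFor x t B
  | .all y A => x ∈ fv A \ {y} → t ≠ y ∧ FreeFor x t A
  | .ex y A => x ∈ fv A \ {y} → t ≠ y ∧ FreeFor x t A

end Formula

/-- Derivability in QC from a set of premises. -/
inductive Derives (Γ : Set Formula) : Formula → Prop
  | hyp {A : Formula} : A ∈ Γ → Derives Γ A
  | mp {A B : Formula} : Derives Γ (.imp A B) → Derives Γ A → Derives Γ B
  | gen (x : ℕ) {A : Formula} : Derives Γ A → Derives Γ (.all x A)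
  | impK (A B : Formula) : Derives Γ (.imp A (.imp B A))
  | impS (A B C : Formula) :
      Derives Γ (.imp (.imp A (.imp B C)) (.imp (.imp A B) (.imp A C)))
  | andLeft (A B : Formula) : Derives Γ (.imp (.and A B) A)
  | andRight (A B : Formula) : Derives Γ (.imp (.and A B) B)
  | andIntro (A B : Formula) : Derives Γ (.imp A (.imp B (.and A B)))
  | orLeft (A B : Formula) : Derives Γ (.imp A (.or A B))
  | orRight (A B : Formula) : Derives Γ (.imp B (.or A B))
  | orElim (A B C : Formula) :
      Derives Γ (.imp (.imp A C) (.imp (.imp B C) (.imp (.or A B) C)))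
  | exFalso (A : Formula) : Derives Γ (.imp .bot A)
  | allElim (x t : ℕ) (A : Formula) (h : A.FreeFor x t) :
      Derives Γ (.imp (.all x A) (A.subst x t))
  | exIntro (x t : ℕ) (A : Formula) (h : A.FreeFor x t) :
      Derives Γ (.imp (A.subst x t) (.ex x A))
  | allImp (x : ℕ) (C A : Formula) (h : x ∉ C.fv) :
      Derives Γ (.imp (.all x (.imp C A)) (.imp C (.all x A)))
  | exImp (x : ℕ) (A C : Formula) (h : x ∉ C.fv) :
      Derives Γ (.imp (.all x (.imp A C)) (.imp (.ex x A) C))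
  | dne (A : Formula) : Derives Γ (.imp (.imp (.imp A .bot) .bot) A)

end QC

/-! ### The modal predicate calculus QS4 -/

namespace QS4

/-- Formulas of QS4. -/
inductive Formula : Type
  /-- the `k`-th `n`-ary logical (predicate) variable, applied to individual variables -/
  | var (n k : ℕ) (ts : Fin n → ℕ) : Formula
  /-- the falsity constant `0` -/
  | bot : Formula
  | and : Formula → Formula → Formula
  | or : Formula → Formula → Formula
  | imp : Formula → Formula → Formula
  | all (x : ℕ) : Formula → Formula
  | ex (x : ℕ) : Formula → Formula
  | box : Formula → Formula

namespace Formula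

/-- The parameters (free individual variables) of a formula. -/
def fv : Formula → Set ℕ
  | .var _ _ ts => Set.range ts
  | .bot => ∅
  | .and A B => fv A ∪ fv B
  | .or A B => fv A ∪ fv B
  | .imp A B => fv A ∪ fv B
  | .all x A => fv A \ {x}
  | .ex x A => fv A \ {x}
  | .box A => fv A

/-- `A.subst x t` is the result of replacing every free occurrence of the variable `x` in `A`
by the variable `t`. -/
def subst (x t : ℕ) : Formula → Formula
  | .var n k ts => .var n k (fun i => if ts i = x then t else ts i)
  | .bot => .bot
  | .and A B => .and (subst x t A) (subst x t B)
  | .or A B => .or (subst x t A) (subst x t B)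
  | .imp A B => .imp (subst x t A) (subst x t B)
  | .all y A => .all y (if y = x then A else subst x t A)
  | .ex y A => .ex y (if y = x then A else subst x t A)
  | .box A => .box (subst x t A)

/-- `A.FreeFor x t`: the variable `t` is free for `x` in `A`, i.e. no free occurrence of `x` in `A`
lies within the scope of a quantifier binding `t`. -/
def FreeFor (x t : ℕ) : Formula → Prop
  | .var _ _ _ => True
  | .bot => True
  | .and A B => FreeFor x t A ∧ FreeFor x t B
  | .or A B => FreeFor x t A ∧ FreeFor x t B
  | .imp A B => FreeFor x t A ∧ FreeFor x t B
  | .all y A => x ∈ fv A \ {y} → t ≠ y ∧ FreeFor x t A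
  | .ex y A => x ∈ fv A \ {y} → t ≠ y ∧ FreeFor x t A
  | .box A => FreeFor x t A

end Formula

/-- Derivability in QS4 from a set of premises: QC for all modal formulas, together with the
S4 axioms and necessitation. -/
inductive Derives (Γ : Set Formula) : Formula → Prop
  | hyp {A : Formula} : A ∈ Γ → Derives Γ A
  | mp {A B : Formula} : Derives Γ (.imp A B) → Derives Γ A → Derives Γ B
  | gen (x : ℕ) {A : Formula} : Derives Γ A → Derives Γ (.all x A)
  | impK (A B : Formula) : Derives Γ (.imp A (.imp B A))
  | impS (A B C : Formula) :
      Derives Γ (.imp (.imp A (.imp B C)) (.imp (.imp A B) (.imp A C)))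
  | andLeft (A B : Formula) : Derives Γ (.imp (.and A B) A)
  | andRight (A B : Formula) : Derives Γ (.imp (.and A B) B)
  | andIntro (A B : Formula) : Derives Γ (.imp A (.imp B (.and A B)))
  | orLeft (A B : Formula) : Derives Γ (.imp A (.or A B))
  | orRight (A B : Formula) : Derives Γ (.imp B (.or A B))
  | orElim (A B C : Formula) :
      Derives Γ (.imp (.imp A C) (.imp (.imp B C) (.imp (.or A B) C)))
  | exFalso (A : Formula) : Derives Γ (.imp .bot A)
  | allElim (x t : ℕ) (A : Formula) (h : A.FreeFor x t) :
      Derives Γ (.imp (.all x A) (A.subst x t))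
  | exIntro (x t : ℕ) (A : Formula) (h : A.FreeFor x t) :
      Derives Γ (.imp (A.subst x t) (.ex x A))
  | allImp (x : ℕ) (C A : Formula) (h : x ∉ C.fv) :
      Derives Γ (.imp (.all x (.imp C A)) (.imp C (.all x A)))
  | exImp (x : ℕ) (A C : Formula) (h : x ∉ C.fv) :
      Derives Γ (.imp (.all x (.imp A C)) (.imp (.ex x A) C))
  | dne (A : Formula) : Derives Γ (.imp (.imp (.imp A .bot) .bot) A)
  | boxElim (A : Formula) : Derives Γ (.imp (.box A) A)
  | boxBox (A : Formula) : Derives Γ (.imp (.box A) (.box (.box A)))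
  | boxImp (A B : Formula) : Derives Γ (.imp (.box (.imp A B)) (.imp (.box A) (.box B)))
  | nec {A : Formula} : Derives Γ A → Derives Γ (.box A)

end QS4

/-! ### The joint calculus QHC of problems and propositions -/

namespace QHC

/-- The two types of formulas of QHC. -/
inductive Kind : Type
  | prop
  | prob

/-- Formulas of QHC of each type. The constructors other than `wn` and `oc` give, at type `prop`,
the classical connectives and, at type `prob`, the intuitionistic ones. -/
inductive Formula : Kind → Type
  /-- the `k`-th `n`-ary logical variable of the given type, applied to individual variables -/
  | var (s : Kind) (n k : ℕ) (ts : Fin n → ℕ) : Formula s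
  /-- the classical falsity `0` (type `prop`) or the intuitionistic absurdity `⊥` (type `prob`) -/
  | bot (s : Kind) : Formula s
  | and {s : Kind} : Formula s → Formula s → Formula s
  | or {s : Kind} : Formula s → Formula s → Formula s
  | imp {s : Kind} : Formula s → Formula s → Formula s
  | all {s : Kind} (x : ℕ) : Formula s → Formula s
  | ex {s : Kind} (x : ℕ) : Formula s → Formula s
  /-- the proposition `? α` -/
  | wn : Formula .prob → Formula .prop
  /-- the problem `! p` -/
  | oc : Formula .prop → Formula .prob

namespace Formula

/-- The parameters (free individual variables) of a formula. -/
def fv : {s : Kind} → Formula s → Set ℕ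
  | _, .var _ _ _ ts => Set.range ts
  | _, .bot s => ∅
  | _, .and A B => fv A ∪ fv B
  | _, .or A B => fv A ∪ fv B
  | _, .imp A B => fv A ∪ fv B
  | _, .all x A => fv A \ {x}
  | _, .ex x A => fv A \ {x}
  | _, .wn A => fv A
  | _, .oc A => fv A

/-- `A.subst x t` is the result of replacing every free occurrence of the variable `x` in `A`
by the variable `t`. -/
def subst (x t : ℕ) : {s : Kind} → Formula s → Formula s
  | _, .var s n k ts => .var s n k (fun i => if ts i = x then t else ts i)
  | _, .bot s => .bot s
  | _, .and A B => .and (subst x t A) (subst x t B)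
  | _, .or A B => .or (subst x t A) (subst x t B)
  | _, .imp A B => .imp (subst x t A) (subst x t B)
  | _, .all y A => .all y (if y = x then A else subst x t A)
  | _, .ex y A => .ex y (if y = x then A else subst x t A)
  | _, .wn A => .wn (subst x t A)
  | _, .oc A => .oc (subst x t A)

/-- `A.FreeFor x t`: the variable `t` is free for `x` in `A`, i.e. no free occurrence of `x` in `A`
lies within the scope of a quantifier binding `t`. -/
def FreeFor (x t : ℕ) : {s : Kind} → Formula s → Prop
  | _, .var _ _ _ _ => True
  | _, .bot _ => True
  | _, .and A B => FreeFor x t A ∧ FreeFor x t B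
  | _, .or A B => FreeFor x t A ∧ FreeFor x t B
  | _, .imp A B => FreeFor x t A ∧ FreeFor x t B
  | _, .all y A => x ∈ fv A \ {y} → t ≠ y ∧ FreeFor x t A
  | _, .ex y A => x ∈ fv A \ {y} → t ≠ y ∧ FreeFor x t A
  | _, .wn A => FreeFor x t A
  | _, .oc A => FreeFor x t A

/-- `A ↔ B` -/
def iff {s : Kind} (A B : Formula s) : Formula s := .and (.imp A B) (.imp B A)

/-- `¬ A` -/
def neg {s : Kind} (A : Formula s) : Formula s := .imp A (.bot s)

end Formula

/-- Formulas of QHC of either type. -/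
abbrev AnyFormula : Type := Σ s : Kind, Formula s

/-- Derivability in QHC from a set of premises: intuitionistic predicate logic for all problems
and classical predicate logic for all propositions (the axioms and rules common to both, and
double negation elimination `dne` for propositions only), together with the axioms and rules
for `?` and `!`. -/
inductive Derives (Γ : Set AnyFormula) : {s : Kind} → Formula s → Prop
  | hyp {s : Kind} {A : Formula s} : ⟨s, A⟩ ∈ Γ → Derives Γ A
  | mp {s : Kind} {A B : Formula s} : Derives Γ (.imp A B) → Derives Γ A → Derives Γ B
  | gen {s : Kind} (x : ℕ) {A : Formula s} : Derives Γ A → Derives Γ (.all x A)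
  | impK {s : Kind} (A B : Formula s) : Derives Γ (.imp A (.imp B A))
  | impS {s : Kind} (A B C : Formula s) :
      Derives Γ (.imp (.imp A (.imp B C)) (.imp (.imp A B) (.imp A C)))
  | andLeft {s : Kind} (A B : Formula s) : Derives Γ (.imp (.and A B) A)
  | andRight {s : Kind} (A B : Formula s) : Derives Γ (.imp (.and A B) B)
  | andIntro {s : Kind} (A B : Formula s) : Derives Γ (.imp A (.imp B (.and A B)))
  | orLeft {s : Kind} (A B : Formula s) : Derives Γ (.imp A (.or A B))
  | orRight {s : Kind} (A B : Formula s) : Derives Γ (.imp B (.or A B))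
  | orElim {s : Kind} (A B C : Formula s) :
      Derives Γ (.imp (.imp A C) (.imp (.imp B C) (.imp (.or A B) C)))
  | exFalso {s : Kind} (A : Formula s) : Derives Γ (.imp (.bot s) A)
  | allElim {s : Kind} (x t : ℕ) (A : Formula s) (h : A.FreeFor x t) :
      Derives Γ (.imp (.all x A) (A.subst x t))
  | exIntro {s : Kind} (x t : ℕ) (A : Formula s) (h : A.FreeFor x t) :
      Derives Γ (.imp (A.subst x t) (.ex x A))
  | allImp {s : Kind} (x : ℕ) (C A : Formula s) (h : x ∉ C.fv) :
      Derives Γ (.imp (.all x (.imp C A)) (.imp C (.all x A)))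
  | exImp {s : Kind} (x : ℕ) (A C : Formula s) (h : x ∉ C.fv) :
      Derives Γ (.imp (.all x (.imp A C)) (.imp (.ex x A) C))
  | dne (p : Formula .prop) : Derives Γ (.imp (.imp (.imp p (.bot .prop)) (.bot .prop)) p)
  | wnAnd (α β : Formula .prob) : Derives Γ (.iff (.wn (.and α β)) (.and (.wn α) (.wn β)))
  | wnOr (α β : Formula .prob) : Derives Γ (.iff (.wn (.or α β)) (.or (.wn α) (.wn β)))
  | wnImp (α β : Formula .prob) : Derives Γ (.imp (.wn (.imp α β)) (.imp (.wn α) (.wn β)))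
  | wnBot : Derives Γ (.neg (.wn (.bot .prob)))
  | wnEx (x : ℕ) (α : Formula .prob) : Derives Γ (.iff (.wn (.ex x α)) (.ex x (.wn α)))
  | wnAll (x : ℕ) (α : Formula .prob) : Derives Γ (.imp (.wn (.all x α)) (.all x (.wn α)))
  | wnTop {α : Formula .prob} : Derives Γ α → Derives Γ (.wn α)
  | ocBot : Derives Γ (.neg (.oc (.bot .prop)))
  | wnOc (p : Formula .prop) : Derives Γ (.imp (.wn (.oc p)) p)
  | ocImp (p q : Formula .prop) : Derives Γ (.imp (.oc (.imp p q)) (.imp (.oc p) (.oc q)))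
  | ocTop {p : Formula .prop} : Derives Γ p → Derives Γ (.oc p)
  | ocWn (α : Formula .prob) : Derives Γ (.imp α (.oc (.wn α)))

/-- Consequence in QHC between formulas of arbitrary types. -/
def Consequence (Γ : Set AnyFormula) (A : AnyFormula) : Prop := Derives Γ A.2

end QHC

/-! ### Embeddings and strong conservativity -/

/-- A formula of QC, read as a proposition of QHC. -/
def QC.Formula.toQHC : QC.Formula → QHC.Formula .prop
  | .var n k ts => .var .prop n k ts
  | .bot => .bot .prop
  | .and A B => .and A.toQHC B.toQHC
  | .or A B => .or A.toQHC B.toQHC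
  | .imp A B => .imp A.toQHC B.toQHC
  | .all x A => .all x A.toQHC
  | .ex x A => .ex x A.toQHC

/-- A formula of QS4, read as a proposition of QHC via `□ ↦ ?!`. -/
def QS4.Formula.toQHC : QS4.Formula → QHC.Formula .prop
  | .var n k ts => .var .prop n k ts
  | .bot => .bot .prop
  | .and A B => .and A.toQHC B.toQHC
  | .or A B => .or A.toQHC B.toQHC
  | .imp A B => .imp A.toQHC B.toQHC
  | .all x A => .all x A.toQHC
  | .ex x A => .ex x A.toQHC
  | .box A => .wn (.oc A.toQHC)

/-- A calculus with formulas `F₂` and consequence relation `D₂` is a strongly conservative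
extension, via the embedding `e` of languages, of a calculus with formulas `F₁` and consequence
relation `D₁`: a rule in the language of the smaller calculus is derivable in the bigger calculus
if and only if it is derivable in the smaller one. -/
def IsStronglyConservativeExtension {F₁ F₂ : Type} (D₁ : Set F₁ → F₁ → Prop)
    (D₂ : Set F₂ → F₂ → Prop) (e : F₁ → F₂) : Prop :=
  Function.Injective e ∧ ∀ (Γ : Set F₁) (A : F₁), D₂ (e '' Γ) (e A) ↔ D₁ Γ A

/-! ### Derived rules of QC and QS4 -/

namespace QC

/-! Strong conservativity is obtained from a retraction. If an embedding preserves derivability and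
has a left inverse that also preserves derivability, a derivation in the larger calculus can be
pulled back line by line, premises included, and injectivity is automatic. Over QS4 the retraction
is `QHC.Formula.toQS4`: classical connectives stay, intuitionistic ones are read by Gödel's
translation, `?` is erased and `!` becomes `□`, so `?!` returns to `□`. Boxes are placed only on
problem variables, `→` and `∀`, since `⊥`, `∧`, `∨`, `∃` already preserve the property `A → □A`.
This stability of translated problems (`toQS4_imp_box`) is what `α → !?α` asserts after translation,
and it also validates the intuitionistic axioms (`QHC.Derives.toQS4`). Over QC this retraction is
followed by the erasure of all boxes (`QS4.Derives.erase`). -/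

theorem Derives.imp_refl {Γ : Set Formula} (A : Formula) : Derives Γ (.imp A A) :=
  .mp (.mp (.impS A (.imp A A) A) (.impK A (.imp A A))) (.impK A A)

end QC

namespace QS4

namespace Formula

theorem subst_self (x : ℕ) (A : Formula) : A.subst x x = A := by
  induction A with
  | var n k ts =>
    simp only [subst]
    congr 1
    funext i
    split_ifs with h
    · exact h.symm
    · rfl
  | _ => simp_all [subst]

theorem freeFor_self (x : ℕ) (A : Formula) : A.FreeFor x x := by
  induction A with
  | var => trivial
  | bot => trivial
  | and _ _ hA hB => exact ⟨hA, hB⟩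
  | or _ _ hA hB => exact ⟨hA, hB⟩
  | imp _ _ hA hB => exact ⟨hA, hB⟩
  | all _ _ hA => exact fun h => ⟨h.2, hA⟩
  | ex _ _ hA => exact fun h => ⟨h.2, hA⟩
  | box _ hA => exact hA

end Formula

namespace Derives

variable {Γ : Set Formula} {A B C : Formula}

theorem weaken (h : Derives Γ A) (B : Formula) : Derives Γ (.imp B A) :=
  .mp (.impK A B) h

/-- Modus ponens under an antecedent. Such combinators stand in for the deduction theorem, which
fails when generalization and necessitation apply to premises. -/
theorem imp_mp (h₁ : Derives Γ (.imp C (.imp A B))) (h₂ : Derives Γ (.imp C A)) :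
    Derives Γ (.imp C B) :=
  .mp (.mp (.impS C A B) h₁) h₂

theorem imp_refl (A : Formula) : Derives Γ (.imp A A) :=
  imp_mp (.impK A (.imp A A)) (.impK A A)

theorem imp_trans (h₁ : Derives Γ (.imp A B)) (h₂ : Derives Γ (.imp B C)) :
    Derives Γ (.imp A C) :=
  imp_mp (weaken h₂ A) h₁

theorem imp_swap (h : Derives Γ (.imp A (.imp B C))) : Derives Γ (.imp B (.imp A C)) :=
  imp_trans (.impK B A) (.mp (.impS A B C) h)

theorem imp_postcomp (h : Derives Γ (.imp B C)) (A : Formula) :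
    Derives Γ (.imp (.imp A B) (.imp A C)) :=
  .mp (.impS A B C) (weaken h A)

theorem iff_refl (A : Formula) : Derives Γ (.and (.imp A A) (.imp A A)) :=
  .mp (.mp (.andIntro _ _) (imp_refl A)) (imp_refl A)

theorem all_elim (x : ℕ) (A : Formula) : Derives Γ (.imp (.all x A) A) := by
  simpa only [A.subst_self x] using Derives.allElim (Γ := Γ) x x A (A.freeFor_self x)

theorem ex_intro (x : ℕ) (A : Formula) : Derives Γ (.imp A (.ex x A)) := by
  simpa only [A.subst_self x] using Derives.exIntro (Γ := Γ) x x A (A.freeFor_self x)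

theorem all_mono (x : ℕ) (h : Derives Γ (.imp A B)) :
    Derives Γ (.imp (.all x A) (.all x B)) :=
  .mp (.allImp x _ _ fun hx => hx.2 rfl) (.gen x (imp_trans (all_elim x A) h))

theorem box_mono (h : Derives Γ (.imp A B)) : Derives Γ (.imp (.box A) (.box B)) :=
  .mp (.boxImp A B) (.nec h)

/-- A formula implied by a formula `A` with `A → □ A` is necessarily so. -/
theorem imp_box (hA : Derives Γ (.imp A (.box A))) (h : Derives Γ (.imp A B)) :
    Derives Γ (.imp A (.box B)) :=
  imp_trans hA (box_mono h)

/-- Boxing under `A` gives `□(B → C)`, hence `□B → □C` by K; stability of `B` then replaces `□B` by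
`B`. -/
theorem imp_imp_box (hA : Derives Γ (.imp A (.box A))) (hB : Derives Γ (.imp B (.box B)))
    (h : Derives Γ (.imp A (.imp B C))) : Derives Γ (.imp A (.imp B (.box C))) :=
  imp_swap (imp_trans hB (imp_swap (imp_trans (imp_box hA h) (.boxImp B C))))

/-- A nested strict implication between formulas implying their own necessity. -/
theorem nec_imp_box_imp (hA : Derives Γ (.imp A (.box A))) (h : Derives Γ (.imp A (.imp B C))) :
    Derives Γ (.box (.imp A (.box (.imp B C)))) :=
  .nec (imp_box hA h)

end Derives

end QS4

/-! ### The embeddings of QC and QS4 in QHC preserve derivability -/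

namespace QC.Formula

theorem fv_toQHC (A : QC.Formula) : A.toQHC.fv = A.fv := by
  induction A <;> simp_all [toQHC, fv, QHC.Formula.fv]

theorem toQHC_subst (x t : ℕ) (A : QC.Formula) :
    (A.subst x t).toQHC = A.toQHC.subst x t := by
  induction A <;> simp_all [toQHC, subst, QHC.Formula.subst, apply_ite toQHC]

theorem freeFor_toQHC (x t : ℕ) (A : QC.Formula) :
    A.toQHC.FreeFor x t ↔ A.FreeFor x t := by
  induction A <;> simp_all [toQHC, FreeFor, QHC.Formula.FreeFor, fv_toQHC]

end QC.Formula

namespace QS4.Formula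

theorem fv_toQHC (A : QS4.Formula) : A.toQHC.fv = A.fv := by
  induction A <;> simp_all [toQHC, fv, QHC.Formula.fv]

theorem toQHC_subst (x t : ℕ) (A : QS4.Formula) :
    (A.subst x t).toQHC = A.toQHC.subst x t := by
  induction A <;> simp_all [toQHC, subst, QHC.Formula.subst, apply_ite toQHC]

theorem freeFor_toQHC (x t : ℕ) (A : QS4.Formula) :
    A.toQHC.FreeFor x t ↔ A.FreeFor x t := by
  induction A <;> simp_all [toQHC, FreeFor, QHC.Formula.FreeFor, fv_toQHC]

end QS4.Formula

theorem QC.Derives.toQHC {Γ : Set QC.Formula} {A : QC.Formula} (h : QC.Derives Γ A) :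
    QHC.Derives ((fun A : QC.Formula => (⟨.prop, A.toQHC⟩ : QHC.AnyFormula)) '' Γ) A.toQHC := by
  induction h with
  | hyp h => exact .hyp ⟨_, h, rfl⟩
  | mp _ _ h₁ h₂ => exact .mp h₁ h₂
  | gen x _ h => exact .gen x h
  | impK => exact .impK _ _
  | impS => exact .impS _ _ _
  | andLeft => exact .andLeft _ _
  | andRight => exact .andRight _ _
  | andIntro => exact .andIntro _ _
  | orLeft => exact .orLeft _ _
  | orRight => exact .orRight _ _
  | orElim => exact .orElim _ _ _
  | exFalso => exact .exFalso _
  | allElim x t A h =>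
    simpa only [← QC.Formula.toQHC_subst, QC.Formula.toQHC] using
      QHC.Derives.allElim x t A.toQHC ((A.freeFor_toQHC x t).2 h)
  | exIntro x t A h =>
    simpa only [← QC.Formula.toQHC_subst, QC.Formula.toQHC] using
      QHC.Derives.exIntro x t A.toQHC ((A.freeFor_toQHC x t).2 h)
  | allImp x C A h => exact .allImp x _ _ (by rwa [C.fv_toQHC])
  | exImp x A C h => exact .exImp x _ _ (by rwa [C.fv_toQHC])
  | dne => exact .dne _

theorem QHC.Derives.wn_mono {Γ : Set QHC.AnyFormula} {α β : QHC.Formula .prob}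
    (h : QHC.Derives Γ (.imp α β)) : QHC.Derives Γ (.imp (.wn α) (.wn β)) :=
  .mp (.wnImp α β) (.wnTop h)

theorem QHC.Derives.syllogism {Γ : Set QHC.AnyFormula} {s : QHC.Kind} {A B C : QHC.Formula s}
    (h₁ : QHC.Derives Γ (.imp A B)) (h₂ : QHC.Derives Γ (.imp B C)) :
    QHC.Derives Γ (.imp A C) :=
  .mp (.mp (.impS A B C) (.mp (.impK _ A) h₂)) h₁

theorem QS4.Derives.toQHC {Γ : Set QS4.Formula} {A : QS4.Formula} (h : QS4.Derives Γ A) :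
    QHC.Derives ((fun A : QS4.Formula => (⟨.prop, A.toQHC⟩ : QHC.AnyFormula)) '' Γ) A.toQHC := by
  induction h with
  | hyp h => exact .hyp ⟨_, h, rfl⟩
  | mp _ _ h₁ h₂ => exact .mp h₁ h₂
  | gen x _ h => exact .gen x h
  | impK => exact .impK _ _
  | impS => exact .impS _ _ _
  | andLeft => exact .andLeft _ _
  | andRight => exact .andRight _ _
  | andIntro => exact .andIntro _ _
  | orLeft => exact .orLeft _ _
  | orRight => exact .orRight _ _
  | orElim => exact .orElim _ _ _
  | exFalso => exact .exFalso _
  | allElim x t A h =>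
    simpa only [← QS4.Formula.toQHC_subst, QS4.Formula.toQHC] using
      QHC.Derives.allElim x t A.toQHC ((A.freeFor_toQHC x t).2 h)
  | exIntro x t A h =>
    simpa only [← QS4.Formula.toQHC_subst, QS4.Formula.toQHC] using
      QHC.Derives.exIntro x t A.toQHC ((A.freeFor_toQHC x t).2 h)
  | allImp x C A h => exact .allImp x _ _ (by rwa [C.fv_toQHC])
  | exImp x A C h => exact .exImp x _ _ (by rwa [C.fv_toQHC])
  | dne => exact .dne _
  | boxElim => exact .wnOc _
  -- Axiom 4 is `α → !?α` at `α = !p`, with `?` applied to both sides.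
  | boxBox => exact .wn_mono (.ocWn _)
  | boxImp => exact .syllogism (.wn_mono (.ocImp _ _)) (.wnImp _ _)
  | nec _ h => exact .wnTop (.ocTop h)

/-! ### The Gödel-type translation of QHC in QS4 -/

namespace QHC

namespace Formula

/-- The translation of QHC in QS4 that is the identity on the classical connectives, reads the
intuitionistic ones by Gödel's translation, erases `?` and reads `!` as `□`. -/
def toQS4 : {s : Kind} → Formula s → QS4.Formula
  | .prop, .var _ n k ts => .var n k ts
  -- A proposition variable and a problem variable with equal indices share one QS4 variable. This
  -- is harmless: a left inverse is needed only on images of QS4 formulas.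
  | .prob, .var _ n k ts => .box (.var n k ts)
  | _, .bot _ => .bot
  | _, .and A B => .and (toQS4 A) (toQS4 B)
  | _, .or A B => .or (toQS4 A) (toQS4 B)
  | .prop, .imp A B => .imp (toQS4 A) (toQS4 B)
  | .prob, .imp A B => .box (.imp (toQS4 A) (toQS4 B))
  | .prop, .all x A => .all x (toQS4 A)
  | .prob, .all x A => .box (.all x (toQS4 A))
  | _, .ex x A => .ex x (toQS4 A)
  | _, .wn α => toQS4 α
  | _, .oc p => .box (toQS4 p)

theorem fv_toQS4 {s : Kind} (A : Formula s) : A.toQS4.fv = A.fv := by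
  induction A with
  | var s => cases s <;> simp [toQS4, fv, QS4.Formula.fv]
  | @imp s => cases s <;> simp_all [toQS4, fv, QS4.Formula.fv]
  | @all s => cases s <;> simp_all [toQS4, fv, QS4.Formula.fv]
  | _ => simp_all [toQS4, fv, QS4.Formula.fv]

theorem toQS4_subst (x t : ℕ) {s : Kind} (A : Formula s) :
    (A.subst x t).toQS4 = A.toQS4.subst x t := by
  induction A with
  | var s => cases s <;> simp [toQS4, subst, QS4.Formula.subst]
  | @imp s => cases s <;> simp_all [toQS4, subst, QS4.Formula.subst]
  | @all s => cases s <;> simp_all [toQS4, subst, QS4.Formula.subst, apply_ite toQS4]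
  | _ => simp_all [toQS4, subst, QS4.Formula.subst, apply_ite toQS4]

theorem freeFor_toQS4 (x t : ℕ) {s : Kind} (A : Formula s) :
    A.toQS4.FreeFor x t ↔ A.FreeFor x t := by
  induction A with
  | var s => cases s <;> simp [toQS4, FreeFor, QS4.Formula.FreeFor]
  | @imp s => cases s <;> simp_all [toQS4, FreeFor, QS4.Formula.FreeFor]
  | @all s => cases s <;> simp_all [toQS4, FreeFor, QS4.Formula.FreeFor, fv_toQS4]
  | _ => simp_all [toQS4, FreeFor, QS4.Formula.FreeFor, fv_toQS4]

open QS4.Derives in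
/-- Translations of problems imply their own necessity. -/
theorem toQS4_imp_box {Γ : Set QS4.Formula} :
    {s : Kind} → (A : Formula s) → s = .prob →
      QS4.Derives Γ (.imp A.toQS4 (.box A.toQS4))
  | .prob, .var _ _ _ _, _ => .boxBox _
  | .prob, .bot _, _ => .exFalso _
  -- K yields `□A → □B → □(A ∧ B)`, and both conjuncts are stable by recursion.
  | .prob, .and A B, h =>
    imp_mp (imp_trans (.andLeft _ _)
        (imp_trans (imp_box (toQS4_imp_box A h) (.andIntro _ _)) (.boxImp _ _)))
      (imp_trans (.andRight _ _) (toQS4_imp_box B h))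
  | .prob, .or A B, h =>
    .mp (.mp (.orElim _ _ _) (imp_box (toQS4_imp_box A h) (.orLeft _ _)))
      (imp_box (toQS4_imp_box B h) (.orRight _ _))
  | .prob, .imp _ _, _ => .boxBox _
  | .prob, .all _ _, _ => .boxBox _
  | .prob, .ex x A, h =>
    .mp (.exImp x _ _ fun hx => hx.2 rfl)
      (.gen x (imp_box (toQS4_imp_box A h) (ex_intro x _)))
  | .prob, .oc _, _ => .boxBox _

end Formula

open QS4.Derives in
-- Propositional axioms translate to themselves. An intuitionistic axiom becomes a nest of boxed
-- implications; its classical core holds in QS4, and the boxes can be inserted because each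
-- antecedent crossed is stable.
theorem Derives.toQS4 {Γ : Set AnyFormula} {s : Kind} {A : Formula s} (h : Derives Γ A) :
    QS4.Derives ((fun A : AnyFormula => A.2.toQS4) '' Γ) A.toQS4 := by
  have stable : ∀ α : Formula .prob, QS4.Derives ((fun A : AnyFormula => A.2.toQS4) '' Γ)
      (.imp α.toQS4 (.box α.toQS4)) := fun α => α.toQS4_imp_box rfl
  induction h with
  | hyp h => exact .hyp ⟨_, h, rfl⟩
  | @mp s _ _ _ _ h₁ h₂ =>
    cases s
    · exact .mp h₁ h₂
    -- An implication of problems is translated with an outer box, removed here by T.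
    · exact .mp (.mp (.boxElim _) h₁) h₂
  | @gen s x _ _ h =>
    cases s
    · exact .gen x h
    · exact .nec (.gen x h)
  | @impK s A B =>
    cases s
    · exact .impK _ _
    · exact nec_imp_box_imp (stable A) (.impK _ _)
  | @impS s A B C =>
    cases s
    · exact .impS _ _ _
    -- The two outer antecedents are boxed, hence stable by axiom 4. Beneath the boxes, T strips the
    -- antecedents to those of the classical S axiom.
    · exact nec_imp_box_imp (.boxBox _) (imp_imp_box (.boxBox _) (.boxBox _)
        (imp_trans (imp_trans (.boxElim _) (imp_postcomp (.boxElim _) _))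
          (imp_swap (imp_trans (.boxElim _) (imp_swap (.impS _ _ _))))))
  | @andLeft s =>
    cases s
    · exact .andLeft _ _
    · exact .nec (.andLeft _ _)
  | @andRight s =>
    cases s
    · exact .andRight _ _
    · exact .nec (.andRight _ _)
  | @andIntro s A B =>
    cases s
    · exact .andIntro _ _
    · exact nec_imp_box_imp (stable A) (.andIntro _ _)
  | @orLeft s =>
    cases s
    · exact .orLeft _ _
    · exact .nec (.orLeft _ _)
  | @orRight s =>
    cases s
    · exact .orRight _ _
    · exact .nec (.orRight _ _)
  | @orElim s A B C =>
    cases s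
    · exact .orElim _ _ _
    · exact nec_imp_box_imp (.boxBox _) (imp_imp_box (.boxBox _) (.boxBox _)
        (imp_trans (.boxElim _) (imp_swap (imp_trans (.boxElim _) (imp_swap (.orElim _ _ _))))))
  | @exFalso s =>
    cases s
    · exact .exFalso _
    · exact .nec (.exFalso _)
  | @allElim s x t A h =>
    have h' := QS4.Derives.allElim (Γ := (fun A : AnyFormula => A.2.toQS4) '' Γ) x t A.toQS4
      ((A.freeFor_toQS4 x t).2 h)
    rw [← A.toQS4_subst] at h'
    cases s
    · exact h'
    · exact .nec (imp_trans (.boxElim _) h')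
  | @exIntro s x t A h =>
    have h' := QS4.Derives.exIntro (Γ := (fun A : AnyFormula => A.2.toQS4) '' Γ) x t A.toQS4
      ((A.freeFor_toQS4 x t).2 h)
    rw [← A.toQS4_subst] at h'
    cases s
    · exact h'
    · exact .nec h'
  | @allImp s x C A h =>
    have h' := QS4.Derives.allImp (Γ := (fun A : AnyFormula => A.2.toQS4) '' Γ) x C.toQS4 A.toQS4
      (by rwa [C.fv_toQS4])
    cases s
    · exact h'
    -- Here `C` crosses the box in front of `∀x A`, so its stability is needed; the boxes under `∀x`
    -- in the premise are removed by monotonicity of `∀`.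
    · exact nec_imp_box_imp (.boxBox _) (imp_imp_box (.boxBox _) (stable C)
        (imp_trans (.boxElim _) (imp_trans (all_mono x (.boxElim _)) h')))
  | @exImp s x A C h =>
    have h' := QS4.Derives.exImp (Γ := (fun A : AnyFormula => A.2.toQS4) '' Γ) x A.toQS4 C.toQS4
      (by rwa [C.fv_toQS4])
    cases s
    · exact h'
    · exact nec_imp_box_imp (.boxBox _)
        (imp_trans (.boxElim _) (imp_trans (all_mono x (.boxElim _)) h'))
  | dne => exact .dne _
  -- With `?` erased and `∧`, `∨`, `∃` left unboxed, both sides of each equivalence have the same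
  -- translation.
  | wnAnd => exact iff_refl _
  | wnOr => exact iff_refl _
  | wnImp => exact .boxElim _
  | wnBot => exact imp_refl _
  | wnEx => exact iff_refl _
  | wnAll => exact .boxElim _
  | wnTop _ h => exact h
  -- The negation is one of problems, so the goal is `□(□⊥ → ⊥)`.
  | ocBot => exact .nec (.boxElim _)
  | wnOc => exact .boxElim _
  | ocImp => exact nec_imp_box_imp (.boxBox _) (.boxImp _ _)
  | ocTop _ h => exact .nec h
  | ocWn α => exact .nec (stable α)

end QHC

theorem QS4.Formula.toQS4_toQHC (A : QS4.Formula) : A.toQHC.toQS4 = A := by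
  induction A <;> simp_all [QS4.Formula.toQHC, QHC.Formula.toQS4]

/-! ### Erasing the modality -/

namespace QS4

namespace Formula

/-- The QC formula obtained by erasing all boxes. -/
def erase : Formula → QC.Formula
  | .var n k ts => .var n k ts
  | .bot => .bot
  | .and A B => .and A.erase B.erase
  | .or A B => .or A.erase B.erase
  | .imp A B => .imp A.erase B.erase
  | .all x A => .all x A.erase
  | .ex x A => .ex x A.erase
  | .box A => A.erase

theorem fv_erase (A : Formula) : A.erase.fv = A.fv := by
  induction A <;> simp_all [erase, fv, QC.Formula.fv]

theorem erase_subst (x t : ℕ) (A : Formula) : (A.subst x t).erase = A.erase.subst x t := by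
  induction A <;> simp_all [erase, subst, QC.Formula.subst, apply_ite erase]

theorem freeFor_erase (x t : ℕ) (A : Formula) : A.erase.FreeFor x t ↔ A.FreeFor x t := by
  induction A <;> simp_all [erase, FreeFor, QC.Formula.FreeFor, fv_erase]

end Formula

/-- Reading `□` as the identity turns T, 4 and K into instances of `A → A` and makes necessitation
vacuous. -/
theorem Derives.erase {Γ : Set Formula} {A : Formula} (h : Derives Γ A) :
    QC.Derives (Formula.erase '' Γ) A.erase := by
  induction h with
  | hyp h => exact .hyp ⟨_, h, rfl⟩
  | mp _ _ h₁ h₂ => exact .mp h₁ h₂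
  | gen x _ h => exact .gen x h
  | impK => exact .impK _ _
  | impS => exact .impS _ _ _
  | andLeft => exact .andLeft _ _
  | andRight => exact .andRight _ _
  | andIntro => exact .andIntro _ _
  | orLeft => exact .orLeft _ _
  | orRight => exact .orRight _ _
  | orElim => exact .orElim _ _ _
  | exFalso => exact .exFalso _
  | allElim x t A h =>
    simpa only [← Formula.erase_subst, Formula.erase] using
      QC.Derives.allElim x t A.erase ((A.freeFor_erase x t).2 h)
  | exIntro x t A h =>
    simpa only [← Formula.erase_subst, Formula.erase] using
      QC.Derives.exIntro x t A.erase ((A.freeFor_erase x t).2 h)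
  | allImp x C A h => exact .allImp x _ _ (by rwa [C.fv_erase])
  | exImp x A C h => exact .exImp x _ _ (by rwa [C.fv_erase])
  | dne => exact .dne _
  | boxElim => exact .imp_refl _
  | boxBox => exact .imp_refl _
  | boxImp => exact .imp_refl _
  | nec _ h => exact h

end QS4

theorem QC.Formula.erase_toQS4_toQHC (A : QC.Formula) : A.toQHC.toQS4.erase = A := by
  induction A <;> simp_all [QC.Formula.toQHC, QHC.Formula.toQS4, QS4.Formula.erase]

/-! ### Strong conservativity -/

/-- An embedding preserving consequence is strongly conservative if it has a left inverse
preserving consequence. -/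
theorem IsStronglyConservativeExtension.of_leftInverse {F₁ F₂ : Type}
    {D₁ : Set F₁ → F₁ → Prop} {D₂ : Set F₂ → F₂ → Prop} {e : F₁ → F₂} {r : F₂ → F₁}
    (hre : Function.LeftInverse r e) (he : ∀ Γ A, D₁ Γ A → D₂ (e '' Γ) (e A))
    (hr : ∀ Γ A, D₂ Γ A → D₁ (r '' Γ) (r A)) : IsStronglyConservativeExtension D₁ D₂ e :=
  ⟨hre.injective, fun Γ A => ⟨fun h => by
    simpa only [hre.image_image, hre A] using hr _ _ h, he Γ A⟩⟩

theorem mainTheorem3 :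
    IsStronglyConservativeExtension QC.Derives QHC.Consequence
      (fun A : QC.Formula => (⟨.prop, A.toQHC⟩ : QHC.AnyFormula)) ∧
    IsStronglyConservativeExtension QS4.Derives QHC.Consequence
      (fun A : QS4.Formula => (⟨.prop, A.toQHC⟩ : QHC.AnyFormula)) := by
  constructor
  -- On images of QC formulas no `?` or `!` occurs, so passing through QS4 and erasing boxes returns
  -- the original formula.
  · refine .of_leftInverse (r := fun A => A.2.toQS4.erase)
      QC.Formula.erase_toQS4_toQHC (fun _ _ h => h.toQHC) fun Γ A h => ?_
    simpa only [Set.image_image] using (QHC.Derives.toQS4 h).erase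
  · exact .of_leftInverse (r := fun A => A.2.toQS4)
      QS4.Formula.toQS4_toQHC (fun _ _ h => h.toQHC) fun _ _ h => QHC.Derives.toQS4 h
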